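/- **Setting.** Let $d\ge 1$, $k\ge 2$, $n\ge 0$ be integers, $\Lambda>0$, $\varepsilon\in(0,1]$, $\delta,\beta\in(0,1)$. User $i\in[n]$ holds a point $x_i$ of the Euclidean ball $\mathcal B(0,\Lambda)\subset\mathbb R^d$; $X=(x_1,\dots,x_n)$. For centers $C=(c_1,\dots,c_m)\in(\mathbb R^d)^m$ let ${\rm cost}_X(C)=\sum_{i}\min_j\|x_i-c_j\|^2$, and ${\rm OPT}_m(X)=\inf_{C\in(\mathbb R^d)^m}{\rm cost}_X(C)$. $X$ is *$\phi$-separated for $k$-means* if ${\rm OPT}_k(X)\le\phi^2\cdot{\rm OPT}_{k-1}(X)$. **Protocol LDP-Stable-$k$-Means** (parameters $\Lambda,\varepsilon,\delta$; subroutine $\mathcal A$: a randomized procedure, e.g. an $(\varepsilon,\delta)$-LDP protocol, that outputs $k$ centers; all users' coins below are independent of each other and of $\mathcal A$). 1. Run $\mathcal A$ on $X$ to obtain $B=(b_1,\dots,b_k)$. 2. Let $\hat D_i=\min_{j\ne i}\|b_i-b_j\|$. 3. Let $R_i=\{x\in\mathcal B(0,\Lambda):\|x-b_i\|\le\hat D_i/3\}$.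 Together with the rest $R_0$ of the ball these form a partition into $T=k+1$ regions (if some $b_i$ coincide, their common region is given to the smallest index). 4. (LDP-AVG.) Each user $u$ sends $y_u\in(\mathbb R^d)^T$, whose coordinates are i.i.d. $\mathcal N(0,\sigma^2)$ with $\sigma=\frac{8\Lambda}{\varepsilon}\sqrt{\ln(1.25/\delta)}$, except that $x_u$ is added to $y_{u,s}$ for the $s$ with $x_u\in R_s$. The sizes $r_s=|\{u:x_u\in R_s\}|$ are estimated by an $(\varepsilon/2,0)$-LDP histogram protocol: for every $s$, user $u$ sends the bit $[x_u\in R_s]$, flipped independently with probability $1/(e^{\varepsilon/4}+1)$, and the server puts $\hat r_s=\sum_u\frac{(e^{\varepsilon/4}+1)\cdot{\rm bit}_{u,s}-1}{e^{\varepsilon/4}-1}$. The server sets $\hat c_i=\frac1{\hat r_i}\sum_u y_{u,i}$ for $i\in[k]$ (and $\hat c_i=0$ if $\hat r_i=0$); $\hat C=(\hat c_1,\dots,\hat c_k)$. 5. For each $C\in\{\hat C,B\}$, every user $u$ sends $\min_j\|x_u-c_j\|^2$ plus independent noise $\mathcal N(0,\tau^2)$, $\tau=\frac{8\Lambda^2}{\varepsilon}\sqrt{2\ln(1.25/\delta)}$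 (the Gaussian mechanism for values in $[-4\Lambda^2,4\Lambda^2]$), and the server sums these messages to estimate ${\rm cost}_X(C)$. Output $\hat C$ if its estimate is at most that of $B$, and $B$ otherwise. **Theorem.** There are universal constants $c,C_0>0$ such that the following holds for all $d,n,k,\Lambda,\varepsilon,\delta,\beta$ as above, all real $\beta_1,\phi$, all $v\ge1$ and $t\ge0$ with $\phi^2\le c/v$, every $\phi$-separated $X\in\mathcal B(0,\Lambda)^n$, and every $\mathcal A$. If $\mathcal A$, run on $X$, returns with probability at least $1-\beta_1$ centers $B$ with ${\rm cost}_X(B)\le v\cdot{\rm OPT}_k(X)+t$, then LDP-Stable-$k$-Means, run on $X$ with the subroutine $\mathcal A$, returns with probability at least $1-\beta-\beta_1$ centers $C'$ with $$ {\rm cost}_X(C')\le(1+C_0\phi^2)\cdot{\rm OPT}_k(X)+C_0\left(vt+\frac{k\Lambda^2\sqrt{dn}}{\varepsilon}\cdot\ln\left(\frac{dk}{\beta\delta}\right)\right). $$ -/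

import Mathlib

open MeasureTheory ProbabilityTheory

noncomputable section

/-- Points of `d`-dimensional Euclidean space. -/
abbrev Pt (d : ℕ) : Type := EuclideanSpace ℝ (Fin d)

/-! ### The `k`-means objective -/

/-- Squared distance from `x` to the nearest of the centers `C 0, …, C (k-1)` (used for `1 ≤ k`). -/
def pointCost {d k : ℕ} (x : Pt d) (C : Fin k → Pt d) : ℝ :=
  ⨅ j, ‖x - C j‖ ^ 2

/-- The `k`-means cost of the centers `C` on the database `X`. -/
def kmeansCost {n d k : ℕ} (X : Fin n → Pt d) (C : Fin k → Pt d) : ℝ :=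
  ∑ i, pointCost (X i) C

/-- The lowest possible cost with `k` centers (used for `1 ≤ k`; centers may coincide). -/
def kmeansOpt {n d : ℕ} (k : ℕ) (X : Fin n → Pt d) : ℝ :=
  ⨅ C : Fin k → Pt d, kmeansCost X C

/-- `X` is `φ`-separated for `k`-means (used for `2 ≤ k`). -/
def IsSeparated {n d : ℕ} (φ : ℝ) (k : ℕ) (X : Fin n → Pt d) : Prop :=
  kmeansOpt k X ≤ φ ^ 2 * kmeansOpt (k - 1) X

/-! ### Histograms in the local model

Every user holds an element of a finite set `ι`. For each `u : ι` the user sends the bit telling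
whether its element is `u`, passed through randomized response with parameter `ε / 2` (changing the
element changes two bits, so the messages are `ε`-locally private). The server debiases the sum. -/

/-- Law of the flip coin of randomized response with parameter `η`: the bit is flipped
(coin `true`) with probability `1 / (e ^ η + 1)`. -/
def flipMeasure (η : ℝ) : Measure Bool :=
  ENNReal.ofReal (1 / (Real.exp η + 1)) • Measure.dirac true
    + ENNReal.ofReal (Real.exp η / (Real.exp η + 1)) • Measure.dirac false

instance flipMeasure_isProbabilityMeasure (η : ℝ) : IsProbabilityMeasure (flipMeasure η) := by
  constructor
  have h : 0 < Real.exp η := Real.exp_pos η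
  simp only [flipMeasure, Measure.coe_add, Measure.coe_smul, Pi.add_apply, Pi.smul_apply,
    measure_univ, smul_eq_mul, mul_one]
  rw [← ENNReal.ofReal_add (by positivity) (by positivity), ← add_div, add_comm, div_self,
    ENNReal.ofReal_one]
  positivity

/-- The message of a user holding `z`, with flip coins `flip`. -/
def histReport {ι : Type} [DecidableEq ι] (z : ι) (flip : ι → Bool) : ι → Bool :=
  fun u => xor (decide (z = u)) (flip u)

/-- The server's estimate of the number of users holding `u`, for privacy parameter `ε`. -/
def histEstimate {ι : Type} {n : ℕ} (ε : ℝ) (msg : Fin n → ι → Bool) (u : ι) : ℝ :=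
  ∑ i, ((Real.exp (ε / 2) + 1) * (if msg i u then 1 else 0) - 1) / (Real.exp (ε / 2) - 1)

/-! ### Averages of the points in the regions of a partition -/

/-- Standard deviation of the noise in the averaging protocol. -/
def avgNoiseStd (Λ ε δ : ℝ) : ℝ :=
  8 * Λ / ε * √(Real.log (1.25 / δ))

/-- The message of a user holding `x`, for the partition into the fibres of `region`:
a noise vector for every region, with `x` added in the region that contains `x`. -/
def avgReport {ι : Type} [DecidableEq ι] {d : ℕ} (region : Pt d → ι) (x : Pt d)
    (noise : ι → Fin d → ℝ) : ι → Pt d :=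
  fun s => WithLp.toLp 2 (noise s) + if region x = s then x else 0

/-- The averaging protocol: noisy sum of each region divided by its estimated size, where
the sizes are estimated by the histogram protocol with privacy parameter `ε / 2`. -/
def ldpAvg {ι : Type} [DecidableEq ι] {n d : ℕ} (ε : ℝ) (region : Pt d → ι) (X : Fin n → Pt d)
    (noise : Fin n → ι → Fin d → ℝ) (flip : Fin n → ι → Bool) (s : ι) : Pt d :=
  (histEstimate (ε / 2) (fun i => histReport (region (X i)) (flip i)) s)⁻¹ •
    ∑ i, avgReport region (X i) (noise i) s

/-! ### Sums of bounded reals -/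

/-- Standard deviation of the Gaussian noise that each user adds to a value in `[-r, r]`
(Gaussian mechanism for sensitivity `2 * r`). -/
def sumNoiseStd (r ε δ : ℝ) : ℝ :=
  2 * r / ε * √(2 * Real.log (1.25 / δ))

/-- Estimate of the cost of the public centers `C`: each user sends its own contribution
plus noise, and the server adds up the messages. -/
def costEstimate {n d k : ℕ} (X : Fin n → Pt d) (C : Fin k → Pt d) (noise : Fin n → ℝ) : ℝ :=
  ∑ i, (pointCost (X i) C + noise i)

/-! ### The clustering protocol -/

/-- Distance from `B i` to the nearest other center (used for `2 ≤ k`). -/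
def centerGap {d k : ℕ} (B : Fin k → Pt d) (i : Fin k) : ℝ :=
  ⨅ j : {j : Fin k // j ≠ i}, ‖B i - B j‖

/-- The part of the ball of radius `Λ` that is within a third of the gap of `B i`. -/
def coreRegion {d k : ℕ} (Λ : ℝ) (B : Fin k → Pt d) (i : Fin k) : Set (Pt d) :=
  {x | x ∈ Metric.closedBall 0 Λ ∧ ‖x - B i‖ ≤ centerGap B i / 3}

open Classical in
/-- The partition that is handed to the averaging protocol: the core regions and the rest `none`.
Core regions of distinct centers are disjoint; if several centers coincide, then their
common core region is given to the first of them. -/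
def regionOf {d k : ℕ} (Λ : ℝ) (B : Fin k → Pt d) (x : Pt d) : Option (Fin k) :=
  (List.finRange k).find? (fun i => decide (x ∈ coreRegion Λ B i))

/-- The coins of one user: averaging noise, histogram flips, and the noise for the
estimates of the costs of the new centers and of the old centers. -/
abbrev UserCoins (d k : ℕ) : Type :=
  (Option (Fin k) → Fin d → ℝ) × (Option (Fin k) → Bool) × ℝ × ℝ

/-- The law of the coins of one user: all coordinates independent. -/
def userCoinsMeasure (d k : ℕ) (Λ ε δ : ℝ) : Measure (UserCoins d k) :=
  (Measure.pi fun _ => Measure.pi fun _ =>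
      gaussianReal 0 (Real.toNNReal (avgNoiseStd Λ ε δ ^ 2))).prod
    ((Measure.pi fun _ => flipMeasure (ε / 4)).prod
      ((gaussianReal 0 (Real.toNNReal (sumNoiseStd (4 * Λ ^ 2) ε δ ^ 2))).prod
        (gaussianReal 0 (Real.toNNReal (sumNoiseStd (4 * Λ ^ 2) ε δ ^ 2)))))

instance userCoinsMeasure_isProbabilityMeasure (d k : ℕ) (Λ ε δ : ℝ) :
    IsProbabilityMeasure (userCoinsMeasure d k Λ ε δ) := by
  unfold userCoinsMeasure; infer_instance

/-- The noisy averages of the core regions of the centers `B`. -/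
def noisyCenters {n d k : ℕ} (Λ ε : ℝ) (X : Fin n → Pt d) (B : Fin k → Pt d)
    (ω : Fin n → UserCoins d k) : Fin k → Pt d :=
  fun i => ldpAvg ε (regionOf Λ B) X (fun u => (ω u).1) (fun u => (ω u).2.1) (some i)

/-- The output of the protocol when the subroutine has returned the centers `B` and the users'
coins are `ω`. -/
def ldpStableKMeans {n d k : ℕ} (Λ ε : ℝ) (X : Fin n → Pt d) (B : Fin k → Pt d)
    (ω : Fin n → UserCoins d k) : Fin k → Pt d :=
  if costEstimate X (noisyCenters Λ ε X B ω) (fun u => (ω u).2.2.1)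
      ≤ costEstimate X B (fun u => (ω u).2.2.2)
  then noisyCenters Λ ε X B ω else B

/-- The randomness of an execution on `X`: the centers returned by the subroutine `𝒜`
(given by its output law on each database) and independent coins for every user. -/
def executionMeasure {n d k : ℕ} (𝒜 : (Fin n → Pt d) → Measure (Fin k → Pt d)) (Λ ε δ : ℝ)
    (X : Fin n → Pt d) : Measure ((Fin k → Pt d) × (Fin n → UserCoins d k)) :=
  (𝒜 X).prod (Measure.pi fun _ => userCoinsMeasure d k Λ ε δ)

end

/-!
The proof follows the analysis of separated instances due to Ostrovsky, Rabani, Schulman and Swamy.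
An optimal clustering consists of centroids `c i` with clusters `S i`, and merging `S i` into
another cluster costs at most `|S i| * gap i ^ 2`, so this is at least `OPT_{k-1} - OPT_k`.

If `OPT_{k-1}` is at most a constant times `v * t`, then separation makes `B` itself good enough up
to `O(v * t)`. Otherwise `B` is much cheaper than `OPT_{k-1}`, which forces every `c i` to have a
center of `B` within `gap i / 20` (`exists_aligned_clustering`). Then the region `R i` of the `i`-th
center lies in `S i`, and it misses only points at distance at least `gap i / 4` from `c i`, hence
(`card_sdiff_regionPoints_mul_le`) an `O(φ ^ 2)`-fraction of `S i`, whatever `v` is. So the mean of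
`R i` costs at most `(1 + O(φ ^ 2))` times the optimum on `S i`, and an error `G` in the sum of a
region with at least `4 * G / Λ` points costs another `O(G * Λ)` (`noisy_mean_bounds`). Clusters
with smaller regions have `O(G / Λ)` points: these can use any center of norm at most `2 * Λ`. Only
if all regions are small can the averages all be useless, but then there are so few points that `B`
costs `O(k * G * Λ)` (`kmeansCost_noisy_means_le_or`). This is why the protocol selects the better
of the two candidates.

All noise terms are sums, over the users, of independent sub-Gaussian contributions. For fixed `B`
a union bound over `O(d * k)` such sums gives `G = O(Λ * √(d * n) / ε * log (d * k / (β * δ)))`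
with probability `1 - β` (`one_sub_le_measureReal_small_errors`, `noise_bounds`). The randomness of
the subroutine is handled by integrating over its good outputs `B`.
-/

noncomputable section

/-! ### Costs, centroids and optimal clusterings -/

theorem pointCost_le {d k : ℕ} (x : Pt d) (C : Fin k → Pt d) (j : Fin k) :
    pointCost x C ≤ ‖x - C j‖ ^ 2 :=
  ciInf_le (Set.finite_range _).bddBelow j

theorem exists_pointCost_eq {d k : ℕ} [NeZero k] (x : Pt d) (C : Fin k → Pt d) :
    ∃ j, pointCost x C = ‖x - C j‖ ^ 2 :=
  let ⟨j, hj⟩ := exists_eq_ciInf_of_finite (f := fun j => ‖x - C j‖ ^ 2)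
  ⟨j, hj.symm⟩

theorem pointCost_nonneg {d k : ℕ} (x : Pt d) (C : Fin k → Pt d) : 0 ≤ pointCost x C :=
  Real.iInf_nonneg fun _ => by positivity

theorem kmeansCost_nonneg {n d k : ℕ} (X : Fin n → Pt d) (C : Fin k → Pt d) :
    0 ≤ kmeansCost X C :=
  Finset.sum_nonneg fun _ _ => pointCost_nonneg _ _

theorem kmeansCost_le_sum {n d k : ℕ} (X : Fin n → Pt d) (C : Fin k → Pt d) (f : Fin n → Fin k) :
    kmeansCost X C ≤ ∑ i, ‖X i - C (f i)‖ ^ 2 :=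
  Finset.sum_le_sum fun _ _ => pointCost_le _ _ _

theorem kmeansOpt_le {n d k : ℕ} (X : Fin n → Pt d) (C : Fin k → Pt d) :
    kmeansOpt k X ≤ kmeansCost X C :=
  ciInf_le ⟨0, by rintro _ ⟨C, rfl⟩; exact kmeansCost_nonneg X C⟩ C

theorem kmeansOpt_nonneg {n d : ℕ} (k : ℕ) (X : Fin n → Pt d) : 0 ≤ kmeansOpt k X :=
  Real.iInf_nonneg fun C => kmeansCost_nonneg X C

/-- Huygens' identity: around its centroid `c`, a finite family has the least sum of squared
distances, and moving the reference point to `a` adds `‖c - a‖ ^ 2` per point. -/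
theorem sum_norm_sub_sq_eq {ι E : Type*} [NormedAddCommGroup E] [InnerProductSpace ℝ E]
    (s : Finset ι) (x : ι → E) (c a : E) (h : ∑ i ∈ s, (x i - c) = 0) :
    ∑ i ∈ s, ‖x i - a‖ ^ 2 = ∑ i ∈ s, ‖x i - c‖ ^ 2 + s.card * ‖c - a‖ ^ 2 := by
  have h1 : ∀ i, ‖x i - a‖ ^ 2 = ‖x i - c‖ ^ 2 + 2 * inner ℝ (x i - c) (c - a) + ‖c - a‖ ^ 2 := by
    intro i
    rw [← norm_add_sq_real, sub_add_sub_cancel]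
  simp only [h1, Finset.sum_add_distrib, ← Finset.mul_sum, ← sum_inner, h, inner_zero_left]
  simp

theorem norm_sum_sq_le {ι E : Type*} [SeminormedAddCommGroup E] (s : Finset ι) (x : ι → E) :
    ‖∑ i ∈ s, x i‖ ^ 2 ≤ s.card * ∑ i ∈ s, ‖x i‖ ^ 2 :=
  (pow_le_pow_left₀ (norm_nonneg _) (norm_sum_le s x) 2).trans sq_sum_le_card_mul_sum_sq

/-- The set of (indices of) points assigned to the center `j` by the assignment `f`. -/
def cluster {n k : ℕ} (f : Fin n → Fin k) (j : Fin k) : Finset (Fin n) :=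
  Finset.univ.filter fun i => f i = j

@[simp] theorem mem_cluster {n k : ℕ} {f : Fin n → Fin k} {j : Fin k} {i : Fin n} :
    i ∈ cluster f j ↔ f i = j := by simp [cluster]

theorem sum_cluster {n k : ℕ} {M : Type*} [AddCommMonoid M] (f : Fin n → Fin k) (g : Fin n → M) :
    ∑ j, ∑ i ∈ cluster f j, g i = ∑ i, g i :=
  Finset.sum_fiberwise _ _ _

/-- The centers `c` with the assignment `f` form an optimal `k`-clustering of `X`: every point is
assigned to a nearest center, every center is the centroid of its cluster (vacuously if the
cluster is empty), and the cost is the optimal one. -/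
structure IsOptimalClustering {n d k : ℕ} (X : Fin n → Pt d) (c : Fin k → Pt d)
    (f : Fin n → Fin k) : Prop where
  nearest : ∀ i j, ‖X i - c (f i)‖ ≤ ‖X i - c j‖
  centroid : ∀ j, ∑ i ∈ cluster f j, (X i - c j) = 0
  cost_eq : ∑ i, ‖X i - c (f i)‖ ^ 2 = kmeansOpt k X

/-- The centroids of the clusters of an assignment. -/
def centroids {n d k : ℕ} (X : Fin n → Pt d) (f : Fin n → Fin k) (j : Fin k) : Pt d :=
  ((cluster f j).card : ℝ)⁻¹ • ∑ i ∈ cluster f j, X i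

theorem sum_sub_centroids {n d k : ℕ} (X : Fin n → Pt d) (f : Fin n → Fin k) (j : Fin k) :
    ∑ i ∈ cluster f j, (X i - centroids X f j) = 0 := by
  rcases (cluster f j).eq_empty_or_nonempty with h | h
  · simp [h]
  · have : ((cluster f j).card : ℝ) ≠ 0 := by simpa using h.ne_empty
    rw [Finset.sum_sub_distrib, Finset.sum_const, centroids, ← Nat.cast_smul_eq_nsmul ℝ,
      smul_inv_smul₀ this, sub_self]

theorem sum_centroids_le {n d k : ℕ} (X : Fin n → Pt d) (f : Fin n → Fin k) (C : Fin k → Pt d) :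
    ∑ i, ‖X i - centroids X f (f i)‖ ^ 2 ≤ ∑ i, ‖X i - C (f i)‖ ^ 2 := by
  rw [← sum_cluster f, ← sum_cluster f]
  refine Finset.sum_le_sum fun j _ => ?_
  have h : ∀ D : Fin k → Pt d,
      ∑ i ∈ cluster f j, ‖X i - D (f i)‖ ^ 2 = ∑ i ∈ cluster f j, ‖X i - D j‖ ^ 2 :=
    fun D => Finset.sum_congr rfl fun i hi => by rw [mem_cluster.1 hi]
  rw [h C, h (centroids X f), sum_norm_sub_sq_eq _ _ _ (C j) (sum_sub_centroids X f j)]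
  exact le_add_of_nonneg_right (by positivity)

/-- There are finitely many assignments, so one whose centroids are cheapest exists. -/
theorem exists_isOptimalClustering {n d k : ℕ} [NeZero k] (X : Fin n → Pt d) :
    ∃ (c : Fin k → Pt d) (f : Fin n → Fin k), IsOptimalClustering X c f := by
  obtain ⟨f, hf⟩ := Finite.exists_min
    (fun f : Fin n → Fin k => ∑ i, ‖X i - centroids X f (f i)‖ ^ 2)
  have hle : ∀ C : Fin k → Pt d, ∑ i, ‖X i - centroids X f (f i)‖ ^ 2 ≤ kmeansCost X C := by
    intro C
    choose g hg using fun i => exists_pointCost_eq (X i) C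
    calc _ ≤ ∑ i, ‖X i - centroids X g (g i)‖ ^ 2 := hf g
      _ ≤ ∑ i, ‖X i - C (g i)‖ ^ 2 := sum_centroids_le X g C
      _ = kmeansCost X C := Finset.sum_congr rfl fun i _ => (hg i).symm
  have hcost : ∑ i, ‖X i - centroids X f (f i)‖ ^ 2 = kmeansCost X (centroids X f) :=
    (hle _).antisymm (kmeansCost_le_sum _ _ _)
  refine ⟨centroids X f, f, fun i j => ?_, sum_sub_centroids X f,
    (le_ciInf hle).antisymm (hcost ▸ kmeansOpt_le X _)⟩
  have hi := (Finset.sum_eq_sum_iff_of_le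
    (fun i _ => pointCost_le (X i) (centroids X f) (f i))).1 hcost.symm i (Finset.mem_univ _)
  exact le_of_sq_le_sq (hi ▸ pointCost_le _ _ j) (norm_nonneg _)

namespace IsOptimalClustering

variable {n d k : ℕ} {X : Fin n → Pt d} {c : Fin k → Pt d} {f : Fin n → Fin k}

/-- Relabelling the clusters by a permutation. -/
theorem reindex (h : IsOptimalClustering X c f) (e : Equiv.Perm (Fin k)) :
    IsOptimalClustering X (c ∘ e.symm) (e ∘ f) where
  nearest i j := by simpa using h.nearest i (e.symm j)
  centroid j := by
    have : cluster (e ∘ f) j = cluster f (e.symm j) := by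
      ext i; simp [Equiv.eq_symm_apply]
    rw [this]; exact h.centroid _
  cost_eq := by simpa using h.cost_eq

theorem sum_cost (h : IsOptimalClustering X c f) :
    ∑ j, ∑ i ∈ cluster f j, ‖X i - c j‖ ^ 2 = kmeansOpt k X := by
  rw [← h.cost_eq, ← sum_cluster f]
  exact Finset.sum_congr rfl fun j _ => Finset.sum_congr rfl fun i hi => by rw [mem_cluster.1 hi]

theorem cost_cluster_le (h : IsOptimalClustering X c f) (j : Fin k) :
    ∑ i ∈ cluster f j, ‖X i - c j‖ ^ 2 ≤ kmeansOpt k X := by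
  rw [← h.sum_cost]
  exact Finset.single_le_sum (f := fun j => ∑ i ∈ cluster f j, ‖X i - c j‖ ^ 2)
    (fun _ _ => by positivity) (Finset.mem_univ j)

theorem norm_center_le (h : IsOptimalClustering X c f) {Λ : ℝ}
    (hX : ∀ i, X i ∈ Metric.closedBall (0 : Pt d) Λ) {j : Fin k} (hj : (cluster f j).Nonempty) :
    ‖c j‖ ≤ Λ := by
  have h1 := h.centroid j
  rw [Finset.sum_sub_distrib, Finset.sum_const, sub_eq_zero, ← Nat.cast_smul_eq_nsmul ℝ] at h1
  have h2 := congrArg norm h1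
  have h3 : ‖∑ i ∈ cluster f j, X i‖ ≤ (cluster f j).card * Λ := by
    simpa using norm_sum_le_of_le (cluster f j) (f := X) (n := fun _ => Λ) fun i _ => by
      simpa using hX i
  rw [norm_smul, Real.norm_natCast] at h2
  exact le_of_mul_le_mul_left (h2 ▸ h3) (by simpa using hj.card_pos)

end IsOptimalClustering

theorem centerGap_le {d k : ℕ} (B : Fin k → Pt d) {i j : Fin k} (h : j ≠ i) :
    centerGap B i ≤ ‖B i - B j‖ :=
  ciInf_le (Set.finite_range fun j : {j : Fin k // j ≠ i} => ‖B i - B j‖).bddBelow ⟨j, h⟩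

theorem centerGap_nonneg {d k : ℕ} (B : Fin k → Pt d) (i : Fin k) : 0 ≤ centerGap B i :=
  Real.iInf_nonneg fun _ => norm_nonneg _

theorem exists_centerGap_eq {d k : ℕ} (hk : 2 ≤ k) (B : Fin k → Pt d) (i : Fin k) :
    ∃ j, j ≠ i ∧ centerGap B i = ‖B i - B j‖ := by
  have : Nontrivial (Fin k) := Fin.nontrivial_iff_two_le.2 hk
  obtain ⟨j₀, hj₀⟩ := exists_ne i
  have : Nonempty {j : Fin k // j ≠ i} := ⟨⟨j₀, hj₀⟩⟩
  obtain ⟨j, hj⟩ := exists_eq_ciInf_of_finite (f := fun j : {j : Fin k // j ≠ i} => ‖B i - B j‖)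
  exact ⟨j, j.2, hj.symm⟩

/-- Dropping the center `c i` and moving its cluster to the nearest other center costs at most
`|cluster| * gap ^ 2`. -/
theorem IsOptimalClustering.kmeansOpt_pred_le {n d k : ℕ} {X : Fin n → Pt d} {c : Fin k → Pt d}
    {f : Fin n → Fin k} (h : IsOptimalClustering X c f) (hk : 2 ≤ k) (i : Fin k) :
    kmeansOpt (k - 1) X ≤ kmeansOpt k X + (cluster f i).card * centerGap c i ^ 2 := by
  obtain ⟨j, hj, hgap⟩ := exists_centerGap_eq hk c i
  obtain ⟨m, rfl⟩ : ∃ m, k = m + 1 := ⟨k - 1, by omega⟩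
  have hg : ∀ u, ∃ l, i.succAbove l = if f u = i then j else f u := fun u =>
    Fin.exists_succAbove_eq (by split_ifs with h <;> assumption)
  choose g hg using hg
  calc kmeansOpt m X ≤ kmeansCost X (c ∘ i.succAbove) := kmeansOpt_le _ _
    _ ≤ ∑ u, ‖X u - (c ∘ i.succAbove) (g u)‖ ^ 2 := kmeansCost_le_sum _ _ _
    _ = ∑ l, ∑ u ∈ cluster f l, ‖X u - c (if l = i then j else l)‖ ^ 2 := by
        rw [← sum_cluster f]
        exact Finset.sum_congr rfl fun l _ => Finset.sum_congr rfl fun u hu => by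
          simp [hg, mem_cluster.1 hu]
    _ = ∑ l, (∑ u ∈ cluster f l, ‖X u - c l‖ ^ 2 +
          if l = i then (cluster f i).card * centerGap c i ^ 2 else 0) := by
        refine Finset.sum_congr rfl fun l _ => ?_
        split_ifs with hl
        · subst hl
          rw [sum_norm_sub_sq_eq _ _ _ (c j) (h.centroid l), hgap]
        · simp
    _ = _ := by
        rw [Finset.sum_add_distrib, h.sum_cost]; simp

/-! ### Recovering the optimal clusters from cheap centers -/

/-- If `B` is much cheaper than any `k - 1` centers, then some optimal clustering can be labelled
so that every center of `B` is close, relative to the gaps, to the optimal center with its label.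
Indeed an optimal center without a center of `B` nearby would make `B` as expensive as merging its
cluster into another one, and the gaps make the resulting map of labels injective. -/
theorem exists_aligned_clustering {n d k : ℕ} (hk : 2 ≤ k) (X : Fin n → Pt d) (B : Fin k → Pt d)
    (hlt : kmeansOpt k X < kmeansOpt (k - 1) X)
    (hB : 800 * (kmeansOpt k X + kmeansCost X B) ≤ kmeansOpt (k - 1) X - kmeansOpt k X) :
    ∃ (c : Fin k → Pt d) (f : Fin n → Fin k), IsOptimalClustering X c f ∧
      ∀ i, ‖B i - c i‖ ≤ centerGap c i / 20 := by
  have : NeZero k := ⟨by omega⟩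
  obtain ⟨c, f, h⟩ := exists_isOptimalClustering (k := k) X
  have hmerge := h.kmeansOpt_pred_le hk
  have hgap : ∀ i, 0 < centerGap c i := fun i => by
    refine (centerGap_nonneg c i).lt_of_ne fun h0 => ?_
    have := hmerge i
    rw [← h0] at this
    simp at this
    linarith
  have hclose : ∀ i, ∃ j, ‖B j - c i‖ ≤ centerGap c i / 20 := by
    intro i
    obtain ⟨j, hj⟩ := Finite.exists_min (fun j => ‖B j - c i‖)
    refine ⟨j, ?_⟩
    have hpt : ∀ u, ‖B j - c i‖ ^ 2 ≤ 2 * ‖X u - c i‖ ^ 2 + 2 * pointCost (X u) B := by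
      intro u
      obtain ⟨l, hl⟩ := exists_pointCost_eq (X u) B
      have h1 : ‖B j - c i‖ ≤ ‖X u - c i‖ + ‖X u - B l‖ := by
        refine (hj l).trans ?_
        have := norm_sub_le (X u - c i) (X u - B l)
        rwa [sub_sub_sub_cancel_left] at this
      rw [hl]
      nlinarith [norm_nonneg (B j - c i), sq_nonneg (‖X u - c i‖ - ‖X u - B l‖)]
    have hsum : (cluster f i).card * ‖B j - c i‖ ^ 2 ≤
        2 * (kmeansOpt k X + kmeansCost X B) := by
      calc ((cluster f i).card : ℝ) * ‖B j - c i‖ ^ 2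
          = ∑ u ∈ cluster f i, ‖B j - c i‖ ^ 2 := by simp
        _ ≤ ∑ u ∈ cluster f i, (2 * ‖X u - c i‖ ^ 2 + 2 * pointCost (X u) B) :=
          Finset.sum_le_sum fun u _ => hpt u
        _ = 2 * ∑ u ∈ cluster f i, ‖X u - c i‖ ^ 2 +
            2 * ∑ u ∈ cluster f i, pointCost (X u) B := by
          rw [Finset.sum_add_distrib, Finset.mul_sum, Finset.mul_sum]
        _ ≤ 2 * kmeansOpt k X + 2 * kmeansCost X B := by
          gcongr
          · exact h.cost_cluster_le i
          · exact Finset.sum_le_univ_sum_of_nonneg fun u => pointCost_nonneg _ _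
        _ = _ := by ring
    have hcard : (0 : ℝ) < (cluster f i).card := by
      refine lt_of_le_of_ne (by positivity) fun h0 => ?_
      have := hmerge i
      rw [← h0] at this
      linarith
    refine le_of_sq_le_sq (le_of_mul_le_mul_left ?_ hcard) (by linarith [hgap i])
    have := hmerge i
    linarith
  choose e he using hclose
  have hinj : Function.Injective e := by
    intro i i' hii
    by_contra hne
    have h1 := he i
    have h2 := he i'
    rw [← hii] at h2
    have h3 : ‖c i - c i'‖ ≤ ‖B (e i) - c i‖ + ‖B (e i) - c i'‖ := by
      have := norm_sub_le (B (e i) - c i') (B (e i) - c i)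
      rw [sub_sub_sub_cancel_left] at this
      linarith
    have h4 := centerGap_le c (i := i) (j := i') (Ne.symm hne)
    have h5 := centerGap_le c (i := i') (j := i) hne
    rw [norm_sub_rev] at h5
    linarith [hgap i, hgap i']
  -- Relabel the optimal centers by the labels of the centers of `B` near them.
  let σ : Equiv.Perm (Fin k) := Equiv.ofBijective e (Finite.injective_iff_bijective.1 hinj)
  refine ⟨c ∘ σ.symm, σ ∘ f, h.reindex σ, fun i => ?_⟩
  have hgapσ : centerGap c (σ.symm i) ≤ centerGap (c ∘ σ.symm) i := by
    obtain ⟨j, hj, hj'⟩ := exists_centerGap_eq hk (c ∘ σ.symm) i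
    rw [hj']
    exact centerGap_le c (fun hc => hj (σ.symm.injective hc))
  have hi := he (σ.symm i)
  have : e (σ.symm i) = i := σ.apply_symm_apply i
  rw [this] at hi
  simp only [Function.comp_apply]
  linarith

section Aligned

variable {n d k : ℕ} {Λ : ℝ} {X : Fin n → Pt d} {B c : Fin k → Pt d} {f : Fin n → Fin k}

theorem abs_norm_sub_sub_norm_sub_le {E : Type*} [SeminormedAddCommGroup E] (x a b : E) :
    |‖x - a‖ - ‖x - b‖| ≤ ‖a - b‖ := by
  have := abs_norm_sub_norm_le (x - a) (x - b)
  rwa [sub_sub_sub_cancel_left, norm_sub_rev b a] at this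

/-- The core regions pick out parts of the optimal clusters. -/
theorem assignment_eq_of_mem_coreRegion (h : IsOptimalClustering X c f)
    (hgap : ∀ i, 0 < centerGap c i) (hnear : ∀ i, ‖B i - c i‖ ≤ centerGap c i / 20)
    {u : Fin n} {i : Fin k} (hu : X u ∈ coreRegion Λ B i) : f u = i := by
  by_contra hne
  have h1 := h.nearest u i
  have h2 := centerGap_le B hne
  have h3 := hu.2
  have h4 := centerGap_le c hne
  have h5 := centerGap_le c (Ne.symm hne)
  have h6 := abs_le.1 (abs_norm_sub_sub_norm_sub_le (X u) (B i) (c i))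
  have h7 : ‖B i - B (f u)‖ ≤ ‖B i - c i‖ + ‖c i - c (f u)‖ + ‖B (f u) - c (f u)‖ := by
    have h8 := norm_sub_le (B i - c i + (c i - c (f u))) (B (f u) - c (f u))
    have h9 := norm_add_le (B i - c i) (c i - c (f u))
    have e : B i - c i + (c i - c (f u)) - (B (f u) - c (f u)) = B i - B (f u) := by abel
    rw [e] at h8
    linarith
  have h8 : ‖c i - c (f u)‖ ≤ ‖X u - c i‖ + ‖X u - c (f u)‖ := by
    have := norm_sub_le (X u - c (f u)) (X u - c i)
    rw [sub_sub_sub_cancel_left] at this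
    linarith
  rw [norm_sub_rev (c (f u))] at h5
  linarith [hnear i, hnear (f u), hgap i]

theorem mem_coreRegion_of_regionOf_eq {x : Pt d} {i : Fin k} (h : regionOf Λ B x = some i) :
    x ∈ coreRegion Λ B i := by
  simpa using List.find?_some h

theorem regionOf_eq_some (h : IsOptimalClustering X c f)
    (hgap : ∀ i, 0 < centerGap c i) (hnear : ∀ i, ‖B i - c i‖ ≤ centerGap c i / 20)
    {u : Fin n} {i : Fin k} (hu : X u ∈ coreRegion Λ B i) : regionOf Λ B (X u) = some i := by
  rcases hr : regionOf Λ B (X u) with _ | j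
  · have := List.find?_eq_none.1 hr i (List.mem_finRange i)
    simp [hu] at this
  · rw [← assignment_eq_of_mem_coreRegion h hgap hnear hu,
      ← assignment_eq_of_mem_coreRegion h hgap hnear (mem_coreRegion_of_regionOf_eq hr)]

/-- The (indices of) points in the region that is given to `B i`. -/
def regionPoints (Λ : ℝ) (X : Fin n → Pt d) (B : Fin k → Pt d) (i : Fin k) : Finset (Fin n) :=
  Finset.univ.filter fun u => regionOf Λ B (X u) = some i

theorem regionPoints_subset (h : IsOptimalClustering X c f)
    (hgap : ∀ i, 0 < centerGap c i) (hnear : ∀ i, ‖B i - c i‖ ≤ centerGap c i / 20) (i : Fin k) :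
    regionPoints Λ X B i ⊆ cluster f i := by
  intro u hu
  exact mem_cluster.2 (assignment_eq_of_mem_coreRegion h hgap hnear
    (mem_coreRegion_of_regionOf_eq (by simpa [regionPoints] using hu)))

/-- The points that the core region misses are far from the optimal center, so there are few. -/
theorem card_sdiff_regionPoints_mul_le (hk : 2 ≤ k) (h : IsOptimalClustering X c f)
    (hgap : ∀ i, 0 < centerGap c i) (hnear : ∀ i, ‖B i - c i‖ ≤ centerGap c i / 20)
    (hX : ∀ u, X u ∈ Metric.closedBall (0 : Pt d) Λ) (i : Fin k) :
    (cluster f i \ regionPoints Λ X B i).card * centerGap c i ^ 2 ≤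
      16 * ∑ u ∈ cluster f i, ‖X u - c i‖ ^ 2 := by
  have hfar : ∀ u ∈ cluster f i \ regionPoints Λ X B i,
      centerGap c i ^ 2 ≤ 16 * ‖X u - c i‖ ^ 2 := by
    intro u hu
    have hu' : X u ∉ coreRegion Λ B i := fun hc => (Finset.mem_sdiff.1 hu).2 (by
      simpa [regionPoints] using regionOf_eq_some h hgap hnear hc)
    have h1 : centerGap B i / 3 < ‖X u - B i‖ := by
      by_contra hc
      exact hu' ⟨hX u, not_lt.1 hc⟩
    obtain ⟨j, hj, hj'⟩ := exists_centerGap_eq hk B i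
    have h2 := centerGap_le c hj
    have h3 := centerGap_le c (Ne.symm hj)
    have h4 : ‖c i - c j‖ ≤ ‖B i - c i‖ + ‖B i - B j‖ + ‖B j - c j‖ := by
      have h5 := norm_sub_le (B j - c j + (B i - B j)) (B i - c i)
      have h6 := norm_add_le (B j - c j) (B i - B j)
      have e : B j - c j + (B i - B j) - (B i - c i) = c i - c j := by abel
      rw [e] at h5
      linarith
    rw [norm_sub_rev (c j)] at h3
    have h6 := abs_le.1 (abs_norm_sub_sub_norm_sub_le (X u) (B i) (c i))
    have h7 : centerGap c i ≤ 4 * ‖X u - c i‖ := by linarith [hnear i, hnear j, hgap i]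
    nlinarith [hgap i]
  calc ((cluster f i \ regionPoints Λ X B i).card : ℝ) * centerGap c i ^ 2
      = ∑ u ∈ cluster f i \ regionPoints Λ X B i, centerGap c i ^ 2 := by simp
    _ ≤ ∑ u ∈ cluster f i \ regionPoints Λ X B i, 16 * ‖X u - c i‖ ^ 2 :=
      Finset.sum_le_sum hfar
    _ ≤ ∑ u ∈ cluster f i, 16 * ‖X u - c i‖ ^ 2 :=
      Finset.sum_le_sum_of_subset_of_nonneg Finset.sdiff_subset fun _ _ _ => by positivity
    _ = _ := by rw [Finset.mul_sum]

end Aligned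

/-- The noisy mean of all but a `ρ`-fraction of a set `s` of points with centroid `c`, where the sum
carries the noise `N` and the number of points is only estimated, by `r'`. It has bounded norm,
and as a center for `s` it costs little more than `c`. -/
theorem noisy_mean_bounds {ι E : Type*} [DecidableEq ι] [NormedAddCommGroup E]
    [InnerProductSpace ℝ E] {s r : Finset ι} (hr : r ⊆ s) {x : ι → E} {c N : E}
    {Λ ρ G r' : ℝ} (hΛ : 0 < Λ) (hx : ∀ i, ‖x i‖ ≤ Λ) (hc : ‖c‖ ≤ Λ)
    (hcen : ∑ i ∈ s, (x i - c) = 0) (hρ : ((s \ r).card : ℝ) ≤ ρ * s.card) (hρ' : ρ ≤ 1 / 4)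
    (hr0 : 0 < r.card) (hN : ‖N‖ ≤ G) (hr' : |r' - r.card| * Λ ≤ G) (hG : 4 * G ≤ r.card * Λ) :
    ‖r'⁻¹ • (N + ∑ i ∈ r, x i)‖ ≤ 2 * Λ ∧
    (s.card : ℝ) * ‖c - r'⁻¹ • (N + ∑ i ∈ r, x i)‖ ^ 2 ≤
      7 * ρ * ∑ i ∈ s, ‖x i - c‖ ^ 2 + 5 * (G * Λ) := by
  have hG0 : 0 ≤ G := (norm_nonneg N).trans hN
  have hR : (0 : ℝ) < r.card := by exact_mod_cast hr0
  have hcard : (s.card : ℝ) = (s \ r).card + r.card := by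
    exact_mod_cast (Finset.card_sdiff_add_card_eq_card hr).symm
  set S : ℝ := (s.card : ℝ)
  set R : ℝ := (r.card : ℝ)
  set m : ℝ := ((s \ r).card : ℝ)
  set V := ∑ i ∈ s, ‖x i - c‖ ^ 2
  have hm0 : 0 ≤ m := by positivity
  have hV0 : 0 ≤ V := by positivity
  have hSR : 3 * S ≤ 4 * R := by nlinarith
  -- The estimate `r'` is off by at most `G / Λ`, which is at most `R / 4`.
  have hr'1 : 3 / 4 * R ≤ r' := by
    have h1 : R - r' ≤ |r' - R| := by rw [abs_sub_comm]; exact le_abs_self _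
    have h2 : (R - r') * Λ ≤ R / 4 * Λ := by nlinarith
    linarith [le_of_mul_le_mul_right h2 hΛ]
  have hr'0 : 0 < r' := by linarith
  constructor
  · have h1 : ‖N + ∑ i ∈ r, x i‖ ≤ G + R * Λ := by
      refine (norm_add_le _ _).trans (add_le_add hN ?_)
      simpa [R] using norm_sum_le_of_le r (f := x) (n := fun _ => Λ) fun i _ => hx i
    rw [norm_smul, norm_inv, Real.norm_of_nonneg hr'0.le, inv_mul_le_iff₀ hr'0]
    nlinarith
  · set W := ∑ i ∈ r, (x i - c) with hW
    -- `W` is minus the sum of the deviations of the `m` missing points.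
    have hW2 : ‖W‖ ^ 2 ≤ m * V := by
      have h1 : W = -∑ i ∈ s \ r, (x i - c) := by
        rw [eq_neg_iff_add_eq_zero, add_comm, hW, Finset.sum_sdiff hr, hcen]
      rw [h1, norm_neg]
      refine (norm_sum_sq_le _ _).trans (mul_le_mul_of_nonneg_left ?_ hm0)
      exact Finset.sum_le_sum_of_subset_of_nonneg Finset.sdiff_subset fun _ _ _ => by positivity
    have heq : c - r'⁻¹ • (N + ∑ i ∈ r, x i) = r'⁻¹ • (-W - N + (r' - R) • c) := by
      have h1 : ∑ i ∈ r, x i = W + R • c := by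
        rw [hW, Finset.sum_sub_distrib, Finset.sum_const, ← Nat.cast_smul_eq_nsmul ℝ]
        abel
      rw [h1, eq_inv_smul_iff₀ hr'0.ne', smul_sub, smul_inv_smul₀ hr'0.ne', sub_smul]
      abel
    have hnorm : ‖-W - N + (r' - R) • c‖ ≤ ‖W‖ + 2 * G := by
      have h1 := norm_add_le (-W - N) ((r' - R) • c)
      have h2 := norm_sub_le (-W) N
      rw [norm_neg] at h2
      have h3 : ‖(r' - R) • c‖ ≤ G := by
        rw [norm_smul, Real.norm_eq_abs]
        exact (mul_le_mul_of_nonneg_left hc (abs_nonneg _)).trans hr'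
      linarith
    have hsq : ‖-W - N + (r' - R) • c‖ ^ 2 ≤ 2 * (m * V) + 8 * G ^ 2 := by
      have := pow_le_pow_left₀ (norm_nonneg _) hnorm 2
      nlinarith [sq_nonneg (‖W‖ - 2 * G)]
    rw [heq, norm_smul, norm_inv, Real.norm_of_nonneg hr'0.le, mul_pow, inv_pow]
    have hmV : m * V ≤ ρ * S * V := mul_le_mul_of_nonneg_right hρ hV0
    have hρ0 : 0 ≤ ρ * S := hm0.trans hρ
    have hS0 : 0 ≤ S := by positivity
    have hr'2 : 9 / 16 * R ^ 2 ≤ r' ^ 2 := by nlinarith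
    have hGR : G ^ 2 ≤ G * Λ * R / 4 := by nlinarith
    have hρV : 0 ≤ ρ * V := by
      have : 0 < S := by linarith
      exact mul_nonneg (nonneg_of_mul_nonneg_left hρ0 this) hV0
    have key : S * (2 * (m * V) + 8 * G ^ 2) ≤ (7 * ρ * V + 5 * (G * Λ)) * (9 / 16 * R ^ 2) := by
      have h1 : S * (m * V) ≤ 16 / 9 * (ρ * V) * R ^ 2 := by
        have h2 : S ^ 2 ≤ 16 / 9 * R ^ 2 := by nlinarith
        calc S * (m * V) ≤ S * (ρ * S * V) := mul_le_mul_of_nonneg_left hmV hS0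
          _ = ρ * V * S ^ 2 := by ring
          _ ≤ ρ * V * (16 / 9 * R ^ 2) := mul_le_mul_of_nonneg_left h2 hρV
          _ = _ := by ring
      have h2 : S * G ^ 2 ≤ G * Λ * R ^ 2 / 3 := by
        have h3 : 0 ≤ G * Λ * R / 4 := by positivity
        calc S * G ^ 2 ≤ S * (G * Λ * R / 4) := mul_le_mul_of_nonneg_left hGR hS0
          _ ≤ (4 / 3 * R) * (G * Λ * R / 4) := mul_le_mul_of_nonneg_right (by linarith) h3
          _ = _ := by ring
      have h4 : 0 ≤ ρ * V * R ^ 2 := by positivity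
      have h5 : 0 ≤ G * Λ * R ^ 2 := by positivity
      linarith
    have hpos : 0 ≤ 7 * ρ * V + 5 * (G * Λ) := by
      by_contra hneg
      have h1 : 0 ≤ S * (2 * (m * V) + 8 * G ^ 2) := by positivity
      nlinarith [pow_pos hR 2]
    rw [← mul_assoc, mul_right_comm, ← div_eq_mul_inv, div_le_iff₀ (by positivity)]
    calc S * ‖-W - N + (r' - R) • c‖ ^ 2 ≤ S * (2 * (m * V) + 8 * G ^ 2) :=
          mul_le_mul_of_nonneg_left hsq hS0
      _ ≤ _ := key
      _ ≤ _ := mul_le_mul_of_nonneg_left hr'2 hpos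

/-! ### Concentration of the users' coins -/

/-- A product measure of a set is at least the integral of the measures of its sections, also if the
set is not measurable. -/
theorem lintegral_measure_section_le_prod {α β : Type*} [MeasurableSpace α] [MeasurableSpace β]
    (μ : Measure α) (ν : Measure β) [SFinite ν] (s : Set (α × β)) :
    ∫⁻ x, ν (Prod.mk x ⁻¹' s) ∂μ ≤ μ.prod ν s := by
  rw [← measure_toMeasurable (μ := μ.prod ν) s,
    Measure.prod_apply (measurableSet_toMeasurable _ _)]
  exact lintegral_mono fun x => measure_mono (Set.preimage_mono (subset_toMeasurable _ _))

theorem mul_le_prod_real {α β : Type*} [MeasurableSpace α] [MeasurableSpace β]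
    (μ : Measure α) (ν : Measure β) [IsProbabilityMeasure μ] [IsProbabilityMeasure ν]
    {A : Set α} (hA : MeasurableSet A) (s : Set (α × β)) {p : ℝ}
    (h : ∀ x ∈ A, p ≤ ν.real (Prod.mk x ⁻¹' s)) :
    μ.real A * p ≤ (μ.prod ν).real s := by
  rcases le_total p 0 with hp | hp
  · exact (mul_nonpos_of_nonneg_of_nonpos measureReal_nonneg hp).trans measureReal_nonneg
  have h1 : ENNReal.ofReal p * μ A ≤ μ.prod ν s := by
    calc ENNReal.ofReal p * μ A = ∫⁻ x in A, ENNReal.ofReal p ∂μ := by simp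
      _ ≤ ∫⁻ x in A, ν (Prod.mk x ⁻¹' s) ∂μ :=
        setLIntegral_mono' hA fun x hx => ENNReal.ofReal_le_of_le_toReal (h x hx)
      _ ≤ ∫⁻ x, ν (Prod.mk x ⁻¹' s) ∂μ := setLIntegral_le_lintegral _ _
      _ ≤ _ := lintegral_measure_section_le_prod μ ν s
  have h2 := ENNReal.toReal_mono (measure_ne_top _ _) h1
  rwa [ENNReal.toReal_mul, ENNReal.toReal_ofReal hp, mul_comm] at h2

theorem measurable_kmeansCost {n d k : ℕ} (X : Fin n → Pt d) :
    Measurable fun C : Fin k → Pt d => kmeansCost X C := by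
  unfold kmeansCost pointCost
  fun_prop

theorem hasSubgaussianMGF_gaussianReal (v : NNReal) :
    HasSubgaussianMGF id v (gaussianReal 0 v) where
  integrable_exp_mul t := integrable_exp_mul_gaussianReal t
  mgf_le t := by rw [mgf_id_gaussianReal]; simp

/-- Two-sided Chernoff bound for a sum of independent sub-Gaussian contributions, one from each
coordinate of a power of `μ`. -/
theorem measureReal_lt_abs_sum_le {Ω : Type*} [MeasurableSpace Ω] {μ : Measure Ω}
    [IsProbabilityMeasure μ] {n : ℕ} {g : Fin n → Ω → ℝ} {v : NNReal}
    (hg : ∀ u, HasSubgaussianMGF (g u) v μ) (hv : 0 < v) {l : ℝ} (hl : 0 ≤ l) :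
    (Measure.pi fun _ : Fin n => μ).real {ω | √v * √(2 * n * l) < |∑ u, g u (ω u)|} ≤
      2 * Real.exp (-l) := by
  -- The sub-Gaussian parameter of the sum must not vanish, because of the division by it.
  rcases Nat.eq_zero_or_pos n with rfl | hn
  · simp; positivity
  have hn' : (0 : ℝ) < n := by exact_mod_cast hn
  have hv' : (0 : ℝ) < v := by exact_mod_cast hv
  set s := √v * √(2 * n * l) with hs
  have hs0 : 0 ≤ s := by positivity
  have hs2 : s ^ 2 = 2 * n * v * l := by
    rw [hs, mul_pow, Real.sq_sqrt hv'.le, Real.sq_sqrt (by positivity)]; ring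
  have hind : iIndepFun (fun u (ω : Fin n → Ω) => g u (ω u)) (Measure.pi fun _ => μ) :=
    iIndepFun_pi fun u => (hg u).aemeasurable
  have hsub : ∀ u, HasSubgaussianMGF (fun ω : Fin n → Ω => g u (ω u)) v
      (Measure.pi fun _ => μ) := fun u =>
    HasSubgaussianMGF.of_map (Y := fun ω : Fin n → Ω => ω u) (measurable_pi_apply u).aemeasurable
      (by rw [(measurePreserving_eval (fun _ : Fin n => μ) u).map_eq]; exact hg u)
  have hsum := HasSubgaussianMGF.sum_of_iIndepFun hind (s := Finset.univ) fun u _ => hsub u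
  have hexp : Real.exp (-s ^ 2 / (2 * ((∑ u : Fin n, v : NNReal) : ℝ))) = Real.exp (-l) := by
    congr 1
    rw [hs2]
    simp
    field_simp
  have h1 := hsum.measure_ge_le hs0
  have h2 := hsum.neg.measure_ge_le hs0
  rw [hexp] at h1 h2
  calc _ ≤ (Measure.pi fun _ : Fin n => μ).real
        ({ω | s ≤ ∑ u, g u (ω u)} ∪ {ω | s ≤ (-fun ω : Fin n → Ω => ∑ u, g u (ω u)) ω}) := by
        refine measureReal_mono fun ω hω => ?_
        rcases lt_abs.1 (Set.mem_ofPred.1 hω) with h | h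
        · exact Or.inl h.le
        · exact Or.inr h.le
    _ ≤ _ := measureReal_union_le _ _
    _ ≤ _ := by linarith

section Coins

variable (d k : ℕ) (Λ ε δ : ℝ)

theorem hasSubgaussianMGF_avgNoise (s : Option (Fin k)) (j : Fin d) :
    HasSubgaussianMGF (fun w : UserCoins d k => w.1 s j)
      (Real.toNNReal (avgNoiseStd Λ ε δ ^ 2)) (userCoinsMeasure d k Λ ε δ) := by
  have h : MeasurePreserving (fun w : UserCoins d k => w.1 s j) (userCoinsMeasure d k Λ ε δ)
      (gaussianReal 0 (Real.toNNReal (avgNoiseStd Λ ε δ ^ 2))) :=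
    ((measurePreserving_eval (fun _ : Fin d => gaussianReal 0 _) j).comp
      (measurePreserving_eval (fun _ : Option (Fin k) => Measure.pi fun _ : Fin d =>
        gaussianReal 0 (Real.toNNReal (avgNoiseStd Λ ε δ ^ 2))) s)).comp measurePreserving_fst
  exact HasSubgaussianMGF.of_map (X := id) h.measurable.aemeasurable
    (by rw [h.map_eq]; exact hasSubgaussianMGF_gaussianReal _)

theorem hasSubgaussianMGF_costNoise_new :
    HasSubgaussianMGF (fun w : UserCoins d k => w.2.2.1)
      (Real.toNNReal (sumNoiseStd (4 * Λ ^ 2) ε δ ^ 2)) (userCoinsMeasure d k Λ ε δ) := by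
  have h : MeasurePreserving (fun w : UserCoins d k => w.2.2.1) (userCoinsMeasure d k Λ ε δ)
      (gaussianReal 0 (Real.toNNReal (sumNoiseStd (4 * Λ ^ 2) ε δ ^ 2))) :=
    measurePreserving_fst.comp (measurePreserving_snd.comp measurePreserving_snd)
  exact HasSubgaussianMGF.of_map (X := id) h.measurable.aemeasurable
    (by rw [h.map_eq]; exact hasSubgaussianMGF_gaussianReal _)

theorem hasSubgaussianMGF_costNoise_old :
    HasSubgaussianMGF (fun w : UserCoins d k => w.2.2.2)
      (Real.toNNReal (sumNoiseStd (4 * Λ ^ 2) ε δ ^ 2)) (userCoinsMeasure d k Λ ε δ) := by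
  have h : MeasurePreserving (fun w : UserCoins d k => w.2.2.2) (userCoinsMeasure d k Λ ε δ)
      (gaussianReal 0 (Real.toNNReal (sumNoiseStd (4 * Λ ^ 2) ε δ ^ 2))) :=
    measurePreserving_snd.comp (measurePreserving_snd.comp measurePreserving_snd)
  exact HasSubgaussianMGF.of_map (X := id) h.measurable.aemeasurable
    (by rw [h.map_eq]; exact hasSubgaussianMGF_gaussianReal _)

/-- The error that the flip `b` causes in the server's debiased version of the bit `z`, for
randomized response with parameter `η`. -/
def flipError (η : ℝ) (z b : Bool) : ℝ :=
  ((Real.exp η + 1) * (if xor z b then 1 else 0) - 1) / (Real.exp η - 1) - if z then 1 else 0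

theorem hasSubgaussianMGF_flipError {η : ℝ} (hη : 0 < η) (hη' : η ≤ 1 / 4) (z : Bool) :
    HasSubgaussianMGF (flipError η z) (Real.toNNReal ((3 / (2 * η)) ^ 2)) (flipMeasure η) := by
  have he : η ≤ Real.exp η - 1 := by linarith [Real.add_one_le_exp η]
  have he0 : 0 < Real.exp η - 1 := by linarith
  have he' : Real.exp η + 1 ≤ 3 := by
    have := Real.abs_exp_sub_one_le (x := η) (by rw [abs_of_pos hη]; linarith)
    rw [abs_of_pos he0, abs_of_pos hη] at this
    linarith
  set w : ℝ := (Real.exp η + 1) / (Real.exp η - 1) with hw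
  have hw0 : 0 < w := by positivity
  have hint : ∫ b, flipError η z b ∂(flipMeasure η) = 0 := by
    rw [flipMeasure, integral_add_measure
      (Integrable.of_finite.smul_measure ENNReal.ofReal_ne_top)
      (Integrable.of_finite.smul_measure ENNReal.ofReal_ne_top)]
    simp only [integral_smul_measure, integral_dirac]
    rw [ENNReal.toReal_ofReal (by positivity), ENNReal.toReal_ofReal (by positivity)]
    cases z <;> simp [flipError] <;> field_simp <;> ring
  have hbd : ∃ a, ∀ b, flipError η z b ∈ Set.Icc a (a + w) := by
    refine ⟨-1 / (Real.exp η - 1) - (if z then 1 else 0), fun b => ?_⟩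
    have h1 : (Real.exp η + 1 - 1) / (Real.exp η - 1) = -1 / (Real.exp η - 1) + w := by
      rw [hw, ← add_div]; ring_nf
    cases z <;> cases b <;> simp [flipError, hw0.le] <;> simp at h1 <;> constructor <;> linarith
  obtain ⟨a, ha⟩ := hbd
  have h := hasSubgaussianMGF_of_mem_Icc_of_integral_eq_zero (μ := flipMeasure η)
    (measurable_of_finite _).aemeasurable (Filter.Eventually.of_forall ha) hint
  refine ⟨h.integrable_exp_mul, fun t => (h.mgf_le t).trans (Real.exp_le_exp.2 ?_)⟩
  have h2 : w / 2 ≤ 3 / (2 * η) := by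
    rw [hw, div_div, div_le_div_iff₀ (by positivity) (by positivity)]
    nlinarith
  rw [add_sub_cancel_left, Real.coe_toNNReal _ (by positivity)]
  push_cast
  rw [Real.norm_of_nonneg hw0.le]
  gcongr

theorem hasSubgaussianMGF_histError (hε : 0 < ε) (hε' : ε ≤ 1) (z : Bool) (s : Option (Fin k)) :
    HasSubgaussianMGF (fun w : UserCoins d k => flipError (ε / 4) z (w.2.1 s))
      (Real.toNNReal ((6 / ε) ^ 2)) (userCoinsMeasure d k Λ ε δ) := by
  have h : MeasurePreserving (fun w : UserCoins d k => w.2.1 s) (userCoinsMeasure d k Λ ε δ)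
      (flipMeasure (ε / 4)) :=
    (measurePreserving_eval _ s).comp (measurePreserving_fst.comp measurePreserving_snd)
  refine HasSubgaussianMGF.of_map (X := flipError (ε / 4) z) h.measurable.aemeasurable ?_
  rw [h.map_eq]
  convert hasSubgaussianMGF_flipError (η := ε / 4) (by positivity) (by linarith) z using 3
  field_simp
  norm_num

end Coins

/-! ### Noisy averages and the execution of the protocol -/

section Aligned

variable {n d k : ℕ} {Λ : ℝ} {X : Fin n → Pt d} {B c : Fin k → Pt d} {f : Fin n → Fin k}

/-- Averages of the regions, where sums and sizes are known up to errors `G` and `G / Λ`, give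
nearly optimal centers, unless all regions are so small that `B` itself is cheap: a cluster with a
large region has a good average, and a point of a small cluster pays at most `(3 * Λ) ^ 2` for
using the average of any large region. -/
theorem kmeansCost_noisy_means_le_or (hk : 2 ≤ k) (h : IsOptimalClustering X c f)
    (hgap : ∀ i, 0 < centerGap c i) (hnear : ∀ i, ‖B i - c i‖ ≤ centerGap c i / 20)
    (hΛ : 0 < Λ) (hX : ∀ u, X u ∈ Metric.closedBall (0 : Pt d) Λ)
    (hne : ∀ i, (cluster f i).Nonempty) {ρ G : ℝ} (hρ0 : 0 ≤ ρ) (hρ' : ρ ≤ 1 / 4)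
    (hρ : ∀ i, ((cluster f i \ regionPoints Λ X B i).card : ℝ) ≤ ρ * (cluster f i).card)
    {r' : Fin k → ℝ} {N : Fin k → Pt d} (hN : ∀ i, ‖N i‖ ≤ G)
    (hr' : ∀ i, |r' i - (regionPoints Λ X B i).card| * Λ ≤ G) :
    kmeansCost X (fun i => (r' i)⁻¹ • (N i + ∑ u ∈ regionPoints Λ X B i, X u)) ≤
        (1 + 7 * ρ) * kmeansOpt k X + 72 * (k * G * Λ) ∨
      kmeansCost X B ≤ 72 * (k * G * Λ) := by
  set C : Fin k → Pt d := fun i => (r' i)⁻¹ • (N i + ∑ u ∈ regionPoints Λ X B i, X u)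
  have hX' : ∀ u, ‖X u‖ ≤ Λ := fun u => by simpa using hX u
  have hcΛ : ∀ i, ‖c i‖ ≤ Λ := fun i => h.norm_center_le hX (hne i)
  have hG0 : 0 ≤ G := (norm_nonneg _).trans (hN ⟨0, by omega⟩)
  have hsub := fun i => regionPoints_subset (Λ := Λ) h hgap hnear i
  have hcard : ∀ i, 3 * ((cluster f i).card : ℝ) ≤ 4 * (regionPoints Λ X B i).card := by
    intro i
    have h1 : ((cluster f i).card : ℝ) =
        (cluster f i \ regionPoints Λ X B i).card + (regionPoints Λ X B i).card := by
      exact_mod_cast (Finset.card_sdiff_add_card_eq_card (hsub i)).symm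
    have h2 : ρ * ((cluster f i).card : ℝ) ≤ 1 / 4 * (cluster f i).card :=
      mul_le_mul_of_nonneg_right hρ' (by positivity)
    linarith [hρ i]
  have hpos : ∀ i, 0 < (regionPoints Λ X B i).card := by
    intro i
    have h1 : (0 : ℝ) < (cluster f i).card := by exact_mod_cast (hne i).card_pos
    have := hcard i
    exact_mod_cast (by linarith : (0 : ℝ) < (regionPoints Λ X B i).card)
  have hsmall : ∀ i, (regionPoints Λ X B i).card * Λ < 4 * G →
      ((cluster f i).card : ℝ) * (3 * Λ) ^ 2 ≤ 72 * (G * Λ) := by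
    intro i hi
    have h1 : ((cluster f i).card : ℝ) * Λ ≤ 8 * G := by nlinarith [hcard i]
    nlinarith
  have hbig : ∀ i, 4 * G ≤ (regionPoints Λ X B i).card * Λ → ‖C i‖ ≤ 2 * Λ ∧
      (cluster f i).card * ‖c i - C i‖ ^ 2 ≤
        7 * ρ * ∑ u ∈ cluster f i, ‖X u - c i‖ ^ 2 + 5 * (G * Λ) := fun i hi =>
    noisy_mean_bounds (hsub i) hΛ hX' (hcΛ i) (h.centroid i) (hρ i) hρ' (hpos i) (hN i)
      (hr' i) hi
  by_cases hall : ∀ i, (regionPoints Λ X B i).card * Λ < 4 * G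
  · right
    have hb : ∀ u i, ‖X u - B i‖ ≤ 3 * Λ := by
      intro u i
      obtain ⟨j, -, hj⟩ := exists_centerGap_eq hk c i
      have h1 := norm_sub_le (X u - c i) (B i - c i)
      rw [sub_sub_sub_cancel_right] at h1
      linarith [hnear i, norm_sub_le (c i) (c j), norm_sub_le (X u) (c i), hX' u, hcΛ i, hcΛ j]
    calc kmeansCost X B ≤ ∑ u, ‖X u - B (f u)‖ ^ 2 := kmeansCost_le_sum X B f
      _ = ∑ i, ∑ u ∈ cluster f i, ‖X u - B (f u)‖ ^ 2 := (sum_cluster f _).symm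
      _ ≤ ∑ i : Fin k, 72 * (G * Λ) := by
        refine Finset.sum_le_sum fun i _ => le_trans ?_ (hsmall i (hall i))
        rw [← nsmul_eq_mul]
        exact Finset.sum_le_card_nsmul _ _ _ fun u _ => pow_le_pow_left₀ (norm_nonneg _) (hb _ _) 2
      _ = 72 * (k * G * Λ) := by
        rw [Finset.sum_const, Finset.card_univ, Fintype.card_fin, nsmul_eq_mul]; ring
  · left
    obtain ⟨j₀, hj₀⟩ := not_forall.1 hall
    have hj₀' := hbig j₀ (not_lt.1 hj₀)
    -- Points of clusters with small regions are assigned to one fixed large region.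
    let g : Fin k → Fin k := fun i => if (regionPoints Λ X B i).card * Λ < 4 * G then j₀ else i
    calc kmeansCost X C ≤ ∑ u, ‖X u - C (g (f u))‖ ^ 2 := kmeansCost_le_sum X C (g ∘ f)
      _ = ∑ i, ∑ u ∈ cluster f i, ‖X u - C (g i)‖ ^ 2 := by
        rw [← sum_cluster f]
        exact Finset.sum_congr rfl fun i _ => Finset.sum_congr rfl fun u hu => by
          rw [mem_cluster.1 hu]
      _ ≤ ∑ i, ((1 + 7 * ρ) * ∑ u ∈ cluster f i, ‖X u - c i‖ ^ 2 + 72 * (G * Λ)) := by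
        refine Finset.sum_le_sum fun i _ => ?_
        have hV : 0 ≤ ∑ u ∈ cluster f i, ‖X u - c i‖ ^ 2 := by positivity
        by_cases hi : (regionPoints Λ X B i).card * Λ < 4 * G
        · have h1 : ∑ u ∈ cluster f i, ‖X u - C (g i)‖ ^ 2 ≤
              (cluster f i).card * (3 * Λ) ^ 2 := by
            rw [← nsmul_eq_mul]
            refine Finset.sum_le_card_nsmul _ _ _ fun u _ =>
              pow_le_pow_left₀ (norm_nonneg _) ?_ 2
            simp only [g, if_pos hi]
            linarith [norm_sub_le (X u) (C j₀), hX' u, hj₀'.1]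
          have h2 := hsmall i hi
          have h3 : 0 ≤ (1 + 7 * ρ) * ∑ u ∈ cluster f i, ‖X u - c i‖ ^ 2 := by positivity
          linarith
        · have h1 := (hbig i (not_lt.1 hi)).2
          simp only [g, if_neg hi]
          rw [sum_norm_sub_sq_eq _ _ _ (C i) (h.centroid i)]
          nlinarith [mul_nonneg hG0 hΛ.le]
      _ = _ := by
        rw [Finset.sum_add_distrib, ← Finset.mul_sum, h.sum_cost, Finset.sum_const,
          Finset.card_univ, Fintype.card_fin, nsmul_eq_mul]
        ring

end Aligned

section Execution

variable {n d k : ℕ}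

/-- The total noise in the sum for the region of the `i`-th center. -/
def totalAvgNoise (ω : Fin n → UserCoins d k) (i : Fin k) : Pt d :=
  ∑ u, WithLp.toLp 2 ((ω u).1 (some i))

/-- The estimated size of the region of the `i`-th center. -/
def estimatedSize (Λ ε : ℝ) (X : Fin n → Pt d) (B : Fin k → Pt d) (ω : Fin n → UserCoins d k)
    (i : Fin k) : ℝ :=
  histEstimate (ε / 2) (fun u => histReport (regionOf Λ B (X u)) (ω u).2.1) (some i)

theorem noisyCenters_eq (Λ ε : ℝ) (X : Fin n → Pt d) (B : Fin k → Pt d)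
    (ω : Fin n → UserCoins d k) :
    noisyCenters Λ ε X B ω = fun i => (estimatedSize Λ ε X B ω i)⁻¹ •
      (totalAvgNoise ω i + ∑ u ∈ regionPoints Λ X B i, X u) := by
  funext i
  simp only [noisyCenters, ldpAvg, avgReport, Finset.sum_add_distrib, regionPoints,
    Finset.sum_filter]
  rfl

theorem estimatedSize_sub_card (Λ ε : ℝ) (X : Fin n → Pt d) (B : Fin k → Pt d)
    (ω : Fin n → UserCoins d k) (i : Fin k) :
    estimatedSize Λ ε X B ω i - (regionPoints Λ X B i).card =
      ∑ u, flipError (ε / 4) (decide (regionOf Λ B (X u) = some i)) ((ω u).2.1 (some i)) := by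
  have : ε / 2 / 2 = ε / 4 := by ring
  simp only [estimatedSize, histEstimate, histReport, flipError, Finset.sum_sub_distrib,
    regionPoints, this, decide_eq_true_eq, Finset.sum_boole]
  congr!

theorem norm_le_sqrt_mul_of_abs_le {x : Pt d} {s : ℝ} (hs : 0 ≤ s) (h : ∀ j, |x j| ≤ s) :
    ‖x‖ ≤ √d * s := by
  rw [EuclideanSpace.norm_eq, Real.sqrt_le_left (by positivity), mul_pow,
    Real.sq_sqrt (by positivity)]
  calc ∑ j, ‖x j‖ ^ 2 ≤ ∑ j : Fin d, s ^ 2 :=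
        Finset.sum_le_sum fun j _ => pow_le_pow_left₀ (norm_nonneg _) (h j) 2
    _ = d * s ^ 2 := by simp

/-- With probability `1 - β` all errors caused by the users' coins are small: those of the region
sizes, of the region sums, and of the two cost estimates. -/
theorem one_sub_le_measureReal_small_errors (hd : 1 ≤ d) (hk : 2 ≤ k) {Λ ε δ β l G T : ℝ}
    (hΛ : 0 < Λ) (hε : 0 < ε) (hε' : ε ≤ 1) (hδ : 0 < δ) (hδ' : δ < 1) (hl : 0 ≤ l)
    (hlβ : 6 * (d * k) * Real.exp (-l) ≤ β) (hsize : 6 / ε * √(2 * n * l) * Λ ≤ G)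
    (havg : √d * (avgNoiseStd Λ ε δ * √(2 * n * l)) ≤ G)
    (hcost : sumNoiseStd (4 * Λ ^ 2) ε δ * √(2 * n * l) ≤ T)
    (X : Fin n → Pt d) (B : Fin k → Pt d) :
    1 - β ≤ (Measure.pi fun _ : Fin n => userCoinsMeasure d k Λ ε δ).real
      {ω | (∀ i, |estimatedSize Λ ε X B ω i - (regionPoints Λ X B i).card| * Λ ≤ G) ∧
        (∀ i, ‖totalAvgNoise ω i‖ ≤ G) ∧ |∑ u, (ω u).2.2.1| ≤ T ∧ |∑ u, (ω u).2.2.2| ≤ T} := by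
  set μ := Measure.pi fun _ : Fin n => userCoinsMeasure d k Λ ε δ
  set S := {ω : Fin n → UserCoins d k |
    (∀ i, |estimatedSize Λ ε X B ω i - (regionPoints Λ X B i).card| * Λ ≤ G) ∧
      (∀ i, ‖totalAvgNoise ω i‖ ≤ G) ∧ |∑ u, (ω u).2.2.1| ≤ T ∧ |∑ u, (ω u).2.2.2| ≤ T}
  have hlog : 0 < Real.log (1.25 / δ) := Real.log_pos (by rw [lt_div_iff₀ hδ]; linarith)
  have hσ : 0 < avgNoiseStd Λ ε δ := by unfold avgNoiseStd; positivity
  have hτ : 0 < sumNoiseStd (4 * Λ ^ 2) ε δ := by unfold sumNoiseStd; positivity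
  have hsqrt : ∀ σ : ℝ, 0 < σ → √(Real.toNNReal (σ ^ 2) : ℝ) = σ := fun σ h => by
    rw [Real.coe_toNNReal _ (by positivity), Real.sqrt_sq h.le]
  set s := √(2 * n * l)
  let E₁ : Fin k → Set (Fin n → UserCoins d k) := fun i => {ω | 6 / ε * s <
    |∑ u, flipError (ε / 4) (decide (regionOf Λ B (X u) = some i)) ((ω u).2.1 (some i))|}
  let E₂ : Fin k → Fin d → Set (Fin n → UserCoins d k) := fun i j =>
    {ω | avgNoiseStd Λ ε δ * s < |∑ u, (ω u).1 (some i) j|}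
  let E₃ : Set (Fin n → UserCoins d k) :=
    {ω | sumNoiseStd (4 * Λ ^ 2) ε δ * s < |∑ u, (ω u).2.2.1|}
  let E₄ : Set (Fin n → UserCoins d k) :=
    {ω | sumNoiseStd (4 * Λ ^ 2) ε δ * s < |∑ u, (ω u).2.2.2|}
  have hE₁ : ∀ i, μ.real (E₁ i) ≤ 2 * Real.exp (-l) := fun i => by
    have := measureReal_lt_abs_sum_le (fun u => hasSubgaussianMGF_histError d k Λ ε δ hε hε'
      (decide (regionOf Λ B (X u) = some i)) (some i)) (Real.toNNReal_pos.2 (by positivity)) hl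
    rwa [hsqrt _ (by positivity)] at this
  have hE₂ : ∀ i j, μ.real (E₂ i j) ≤ 2 * Real.exp (-l) := fun i j => by
    have := measureReal_lt_abs_sum_le (n := n) (fun _ => hasSubgaussianMGF_avgNoise d k Λ ε δ
      (some i) j) (Real.toNNReal_pos.2 (by positivity)) hl
    rwa [hsqrt _ hσ] at this
  have hE₃ : μ.real E₃ ≤ 2 * Real.exp (-l) := by
    have := measureReal_lt_abs_sum_le (n := n) (fun _ =>
      hasSubgaussianMGF_costNoise_new d k Λ ε δ) (Real.toNNReal_pos.2 (by positivity)) hl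
    rwa [hsqrt _ hτ] at this
  have hE₄ : μ.real E₄ ≤ 2 * Real.exp (-l) := by
    have := measureReal_lt_abs_sum_le (n := n) (fun _ =>
      hasSubgaussianMGF_costNoise_old d k Λ ε δ) (Real.toNNReal_pos.2 (by positivity)) hl
    rwa [hsqrt _ hτ] at this
  have hcover : Set.univ ⊆ S ∪ ((⋃ i, E₁ i) ∪ ((⋃ i, ⋃ j, E₂ i j) ∪ (E₃ ∪ E₄))) := by
    intro ω _
    by_contra hω
    simp only [Set.mem_union, not_or, Set.mem_iUnion, not_exists] at hω
    obtain ⟨h0, h1, h2, h3, h4⟩ := hω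
    refine h0 ⟨fun i => ?_, fun i => ?_, (not_lt.1 h3).trans hcost, (not_lt.1 h4).trans hcost⟩
    · rw [estimatedSize_sub_card]
      exact (mul_le_mul_of_nonneg_right (not_lt.1 (h1 i)) hΛ.le).trans hsize
    · refine (norm_le_sqrt_mul_of_abs_le (by positivity) fun j => ?_).trans havg
      simpa [totalAvgNoise] using not_lt.1 (h2 i j)
  have hU₁ : μ.real (⋃ i, E₁ i) ≤ k * (2 * Real.exp (-l)) :=
    (measureReal_iUnion_fintype_le _).trans
      ((Finset.sum_le_sum fun i _ => hE₁ i).trans_eq (by simp))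
  have hU₂ : μ.real (⋃ i, ⋃ j, E₂ i j) ≤ k * (d * (2 * Real.exp (-l))) := by
    have hU : ∀ i, μ.real (⋃ j, E₂ i j) ≤ d * (2 * Real.exp (-l)) := fun i =>
      (measureReal_iUnion_fintype_le _).trans
        ((Finset.sum_le_sum fun j _ => hE₂ i j).trans_eq (by simp))
    exact (measureReal_iUnion_fintype_le _).trans
      ((Finset.sum_le_sum fun i _ => hU i).trans_eq (by simp))
  have h1 : (1 : ℝ) ≤ μ.real S + (μ.real (⋃ i, E₁ i) + (μ.real (⋃ i, ⋃ j, E₂ i j) +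
      (μ.real E₃ + μ.real E₄))) := by
    calc (1 : ℝ) = μ.real Set.univ := probReal_univ.symm
      _ ≤ _ := measureReal_mono hcover
      _ ≤ _ := (measureReal_union_le _ _).trans (add_le_add_right ((measureReal_union_le _ _).trans
        (add_le_add_right ((measureReal_union_le _ _).trans
          (add_le_add_right (measureReal_union_le _ _) _)) _)) _)
  have hd' : (1 : ℝ) ≤ d := by exact_mod_cast hd
  have hk' : (2 : ℝ) ≤ k := by exact_mod_cast hk
  -- There are `k + d * k + 2` events, and `d * k` is at least `k` and at least `2`.
  have hcount : k * (2 * Real.exp (-l)) + (k * (d * (2 * Real.exp (-l))) +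
      (2 * Real.exp (-l) + 2 * Real.exp (-l))) ≤ 6 * (d * k) * Real.exp (-l) := by
    have h2 : 2 * (k : ℝ) + 2 * (d * k) + 4 ≤ 6 * (d * k) := by nlinarith
    nlinarith [Real.exp_pos (-l)]
  linarith

/-- The selected centers are, up to the errors of the two cost estimates, at least as good as
either candidate. -/
theorem kmeansCost_ldpStableKMeans_le {Λ ε T : ℝ} (X : Fin n → Pt d) (B : Fin k → Pt d)
    {ω : Fin n → UserCoins d k} (h₁ : |∑ u, (ω u).2.2.1| ≤ T) (h₂ : |∑ u, (ω u).2.2.2| ≤ T) :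
    kmeansCost X (ldpStableKMeans Λ ε X B ω) ≤
      min (kmeansCost X (noisyCenters Λ ε X B ω)) (kmeansCost X B) + 2 * T := by
  have h3 := abs_le.1 h₁
  have h4 := abs_le.1 h₂
  have h5 : ∀ (C : Fin k → Pt d) (ν : Fin n → ℝ),
      costEstimate X C ν = kmeansCost X C + ∑ u, ν u := fun C ν => Finset.sum_add_distrib
  unfold ldpStableKMeans
  rw [h5, h5]
  split_ifs with h
  all_goals
    rw [← min_add_add_right]
    exact le_min (by linarith) (by linarith)

end Execution

/-! ### The error bound -/

/-- Small errors of the coins give good centers. Either `t` is comparable to the optimal cost of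
`k - 1` centers, and then `B` is good enough, or `B` is so cheap that the clusters are recovered. -/
theorem kmeansCost_ldpStableKMeans_le_of_small_errors {n d k : ℕ} (hk : 2 ≤ k)
    {Λ ε v t φ G T : ℝ} (hΛ : 0 < Λ) (hv : 1 ≤ v) (ht : 0 ≤ t) (hφ : φ ^ 2 ≤ 1 / 10000 / v)
    {X : Fin n → Pt d} (hX : ∀ i, X i ∈ Metric.closedBall (0 : Pt d) Λ) (hsep : IsSeparated φ k X)
    {B : Fin k → Pt d} (hB : kmeansCost X B ≤ v * kmeansOpt k X + t) {ω : Fin n → UserCoins d k}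
    (hsize : ∀ i, |estimatedSize Λ ε X B ω i - (regionPoints Λ X B i).card| * Λ ≤ G)
    (havg : ∀ i, ‖totalAvgNoise ω i‖ ≤ G)
    (hcost₁ : |∑ u, (ω u).2.2.1| ≤ T) (hcost₂ : |∑ u, (ω u).2.2.2| ≤ T) :
    kmeansCost X (ldpStableKMeans Λ ε X B ω) ≤
      (1 + 119 * φ ^ 2) * kmeansOpt k X + 2 * (v * t) + 72 * (k * G * Λ) + 2 * T := by
  have hsel := kmeansCost_ldpStableKMeans_le (Λ := Λ) (ε := ε) X B hcost₁ hcost₂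
  have hG0 : 0 ≤ G := (norm_nonneg _).trans (havg ⟨0, by omega⟩)
  have hE0 : 0 ≤ k * G * Λ := by positivity
  have hopt := kmeansOpt_nonneg k X
  have hopt' := kmeansOpt_nonneg (k - 1) X
  have hsep' : kmeansOpt k X ≤ φ ^ 2 * kmeansOpt (k - 1) X := hsep
  set O := kmeansOpt k X
  set O' := kmeansOpt (k - 1) X
  have hφv : v * φ ^ 2 ≤ 1 / 10000 := by
    rwa [le_div_iff₀ (by linarith), mul_comm] at hφ
  have hφ1 : φ ^ 2 ≤ 1 / 10000 := by nlinarith [sq_nonneg φ]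
  have hvO : v * O ≤ 1 / 10000 * O' := by
    calc v * O ≤ v * (φ ^ 2 * O') := mul_le_mul_of_nonneg_left hsep' (by linarith)
      _ = v * φ ^ 2 * O' := by ring
      _ ≤ _ := mul_le_mul_of_nonneg_right hφv hopt'
  have hOvO : O ≤ v * O := le_mul_of_one_le_left hopt hv
  have htvt : t ≤ v * t := le_mul_of_one_le_left ht hv
  have hφO : 0 ≤ 119 * φ ^ 2 * O := by positivity
  have hvt0 : 0 ≤ v * t := by positivity
  have hmin₁ := min_le_left (kmeansCost X (noisyCenters Λ ε X B ω)) (kmeansCost X B)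
  have hmin₂ := min_le_right (kmeansCost X (noisyCenters Λ ε X B ω)) (kmeansCost X B)
  rcases le_or_gt O' (2000 * (v * t)) with hcase | hcase
  · linarith
  obtain ⟨c, f, h, hnear⟩ := exists_aligned_clustering hk X B
    (show O < O' by linarith) (show 800 * (O + kmeansCost X B) ≤ O' - O by linarith)
  have hmerge : ∀ i, O' ≤ O + (cluster f i).card * centerGap c i ^ 2 := h.kmeansOpt_pred_le hk
  have hprod : ∀ i, 0 < ((cluster f i).card : ℝ) * centerGap c i ^ 2 := fun i => by
    linarith [hmerge i]
  have hgap : ∀ i, 0 < centerGap c i := fun i => by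
    refine (centerGap_nonneg c i).lt_of_ne fun h0 => ?_
    have := hprod i
    simp [← h0] at this
  have hne : ∀ i, (cluster f i).Nonempty := fun i => by
    rw [← Finset.card_pos]
    exact_mod_cast pos_of_mul_pos_left (hprod i) (sq_nonneg _)
  have hρ : ∀ i, ((cluster f i \ regionPoints Λ X B i).card : ℝ) ≤
      17 * φ ^ 2 * (cluster f i).card := fun i => by
    have h1 := card_sdiff_regionPoints_mul_le hk h hgap hnear hX i
    have h2 : ∑ u ∈ cluster f i, ‖X u - c i‖ ^ 2 ≤ O := h.cost_cluster_le i
    have h3 : φ ^ 2 * (9999 / 10000 * O') ≤ φ ^ 2 * ((cluster f i).card * centerGap c i ^ 2) :=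
      mul_le_mul_of_nonneg_left (by linarith [hmerge i]) (sq_nonneg _)
    have h4 : 0 ≤ φ ^ 2 * O' := by positivity
    refine le_of_mul_le_mul_right ?_ (pow_pos (hgap i) 2)
    linarith
  have hfin := kmeansCost_noisy_means_le_or hk h hgap hnear hΛ hX hne
    (by positivity) (by linarith) hρ havg hsize
  rw [← noisyCenters_eq] at hfin
  rcases hfin with hfin | hfin
  · change _ ≤ (1 + 7 * (17 * φ ^ 2)) * O + _ at hfin
    linarith
  · linarith

/-- Comparison of the noise levels with the additive error of the theorem, in terms of
`L = log (d * k / (β * δ))`. -/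
theorem noise_bounds {d n k : ℕ} (hd : 1 ≤ d) (hk : 2 ≤ k) {Λ ε δ β L l : ℝ}
    (hΛ : 0 < Λ) (hε : 0 < ε) (hδ : 0 < δ) (hδ' : δ < 1) (hβ : 0 < β) (hβ' : β < 1)
    (hL : L = Real.log (d * k / (β * δ))) (hl : l = Real.log (6 * (d * k) / β)) :
    0 ≤ l ∧ 6 / ε * √(2 * n * l) * Λ ≤ 24 * (Λ * √(d * n) / ε * L) ∧
      √d * (avgNoiseStd Λ ε δ * √(2 * n * l)) ≤ 24 * (Λ * √(d * n) / ε * L) ∧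
      sumNoiseStd (4 * Λ ^ 2) ε δ * √(2 * n * l) ≤ 36 * (k * Λ ^ 2 * √(d * n) / ε * L) := by
  have hd' : (1 : ℝ) ≤ d := by exact_mod_cast hd
  have hk' : (2 : ℝ) ≤ k := by exact_mod_cast hk
  have hdk : (2 : ℝ) ≤ d * k := by nlinarith
  have hLsum : L = Real.log (d * k) + -Real.log β + -Real.log δ := by
    rw [hL, Real.log_div (by positivity) (by positivity), Real.log_mul hβ.ne' hδ.ne']
    ring
  have hlogβ : 0 < -Real.log β := by linarith [Real.log_neg hβ hβ']
  have hlogδ : 0 < -Real.log δ := by linarith [Real.log_neg hδ hδ']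
  have hlogdk : Real.log 2 ≤ Real.log (d * k) := Real.log_le_log (by norm_num) hdk
  have hlog2 := Real.log_two_gt_d9
  -- This is where `2 ≤ d * k` matters: `L` is bounded away from `0`, so `√L = O(L)`.
  have hL2 : 9 / 16 ≤ L := by linarith
  have hlsum : l = Real.log 6 + Real.log (d * k) + -Real.log β := by
    rw [hl, Real.log_div (by positivity) hβ.ne', Real.log_mul (by norm_num) (by positivity)]
    ring
  have hlog6 : Real.log 6 ≤ 3 * Real.log 2 := by
    rw [← Real.log_rpow (by norm_num)]
    exact Real.log_le_log (by norm_num) (by norm_num)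
  have hl4 : l ≤ 4 * L := by linarith
  have hl0 : 0 ≤ l := by
    have : 0 ≤ Real.log 6 := Real.log_nonneg (by norm_num)
    linarith
  have hlog125 : Real.log (1.25 / δ) ≤ L := by
    rw [Real.log_div (by norm_num) hδ.ne']
    have : Real.log 1.25 ≤ Real.log 2 := Real.log_le_log (by norm_num) (by norm_num)
    linarith
  have hL0 : 0 ≤ L := by linarith
  have hs : √(2 * n * l) ≤ 3 * (√n * √L) := by
    rw [Real.sqrt_le_left (by positivity), mul_pow, mul_pow, Real.sq_sqrt (by positivity),
      Real.sq_sqrt hL0]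
    nlinarith [mul_le_mul_of_nonneg_left hl4 (Nat.cast_nonneg (α := ℝ) n),
      mul_nonneg (Nat.cast_nonneg (α := ℝ) n) hL0]
  have hLL : √L * √L = L := Real.mul_self_sqrt hL0
  have hsqL : √L ≤ 4 / 3 * L := by
    rw [Real.sqrt_le_left (by positivity)]
    nlinarith
  have hdn : √((d : ℝ) * n) = √d * √n := Real.sqrt_mul (by positivity) _
  have hsd : 1 ≤ √(d : ℝ) := Real.one_le_sqrt.2 hd'
  have hndn : √(n : ℝ) ≤ √((d : ℝ) * n) := by
    rw [hdn]; exact le_mul_of_one_le_left (by positivity) hsd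
  refine ⟨hl0, ?_, ?_, ?_⟩
  · calc 6 / ε * √(2 * n * l) * Λ ≤ 6 / ε * (3 * (√n * √L)) * Λ := by gcongr
      _ ≤ 6 / ε * (3 * (√(d * n) * (4 / 3 * L))) * Λ := by gcongr
      _ = _ := by ring
  · have h1 : avgNoiseStd Λ ε δ ≤ 8 * Λ / ε * √L := by
      unfold avgNoiseStd; gcongr
    calc √d * (avgNoiseStd Λ ε δ * √(2 * n * l))
        ≤ √d * (8 * Λ / ε * √L * (3 * (√n * √L))) := by gcongr
      _ = 24 * (Λ * (√d * √n) / ε * (√L * √L)) := by ring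
      _ = _ := by rw [hLL, hdn]
  · have h1 : sumNoiseStd (4 * Λ ^ 2) ε δ ≤ 8 * Λ ^ 2 / ε * (3 / 2 * √L) := by
      unfold sumNoiseStd
      have h2 : √(2 * Real.log (1.25 / δ)) ≤ 3 / 2 * √L := by
        rw [Real.sqrt_le_left (by positivity), mul_pow, Real.sq_sqrt hL0]
        linarith
      calc 2 * (4 * Λ ^ 2) / ε * √(2 * Real.log (1.25 / δ))
          ≤ 2 * (4 * Λ ^ 2) / ε * (3 / 2 * √L) := by gcongr
        _ = _ := by ring
    calc sumNoiseStd (4 * Λ ^ 2) ε δ * √(2 * n * l)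
        ≤ 8 * Λ ^ 2 / ε * (3 / 2 * √L) * (3 * (√n * √L)) := by gcongr
      _ = 36 * (1 * Λ ^ 2 * √n / ε * (√L * √L)) := by ring
      _ ≤ 36 * (k * Λ ^ 2 * √(d * n) / ε * L) := by
        rw [hLL]
        gcongr
        linarith

theorem theorem6p4 :
    ∃ c C : ℝ, 0 < c ∧ 0 < C ∧
      ∀ (d n k : ℕ), 1 ≤ d → 2 ≤ k →
      ∀ (Λ ε δ β : ℝ), 0 < Λ → 0 < ε → ε ≤ 1 → 0 < δ → δ < 1 → 0 < β → β < 1 →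
      ∀ (β₁ v t φ : ℝ), 1 ≤ v → 0 ≤ t → φ ^ 2 ≤ c / v →
      ∀ X : Fin n → Pt d, (∀ i, X i ∈ Metric.closedBall (0 : Pt d) Λ) → IsSeparated φ k X →
      ∀ 𝒜 : (Fin n → Pt d) → Measure (Fin k → Pt d), (∀ Y, IsProbabilityMeasure (𝒜 Y)) →
        1 - β₁ ≤ (𝒜 X).real {B | kmeansCost X B ≤ v * kmeansOpt k X + t} →
        1 - β - β₁ ≤ (executionMeasure 𝒜 Λ ε δ X).real
          {ω | kmeansCost X (ldpStableKMeans Λ ε X ω.1 ω.2) ≤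
            (1 + C * φ ^ 2) * kmeansOpt k X +
              C * (v * t + k * Λ ^ 2 * √(d * n) / ε * Real.log (d * k / (β * δ)))} := by
  refine ⟨1 / 10000, 1800, by norm_num, by norm_num, ?_⟩
  intro d n k hd hk Λ ε δ β hΛ hε hε' hδ hδ' hβ hβ' β₁ v t φ hv ht hφ X hX hsep 𝒜 h𝒜 hgood
  have := h𝒜 X
  obtain ⟨hl0, hsize, havg, hcost⟩ :=
    noise_bounds (n := n) hd hk hΛ hε hδ hδ' hβ hβ' rfl rfl
  have hdk : (0 : ℝ) < 6 * (d * k) := by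
    have : (0 : ℝ) < d := by exact_mod_cast hd
    have : (0 : ℝ) < k := by exact_mod_cast (by omega : 0 < k)
    positivity
  have hlβ : 6 * (d * k) * Real.exp (-Real.log (6 * (d * k) / β)) ≤ β := by
    rw [Real.exp_neg, Real.exp_log (by positivity), inv_div, mul_div_cancel₀ _ hdk.ne']
  have hmain := mul_le_prod_real (𝒜 X) (Measure.pi fun _ : Fin n => userCoinsMeasure d k Λ ε δ)
    (A := {B | kmeansCost X B ≤ v * kmeansOpt k X + t})
    (measurableSet_le (measurable_kmeansCost X) measurable_const)
    {ω | kmeansCost X (ldpStableKMeans Λ ε X ω.1 ω.2) ≤ (1 + 1800 * φ ^ 2) * kmeansOpt k X +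
      1800 * (v * t + k * Λ ^ 2 * √(d * n) / ε * Real.log (d * k / (β * δ)))} (p := 1 - β)
    fun B hB => by
      refine (one_sub_le_measureReal_small_errors hd hk hΛ hε hε' hδ hδ' hl0 hlβ hsize havg hcost
        X B).trans (measureReal_mono fun ω hω => ?_)
      obtain ⟨h1, h2, h3, h4⟩ := hω
      have h5 := kmeansCost_ldpStableKMeans_le_of_small_errors hk hΛ hv ht hφ hX hsep hB h1 h2 h3 h4
      refine h5.trans ?_
      have h6 : 0 ≤ φ ^ 2 * kmeansOpt k X := mul_nonneg (sq_nonneg _) (kmeansOpt_nonneg k X)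
      have h7 : 0 ≤ v * t := by positivity
      linear_combination 1681 * h6 + 1798 * h7
  have h1 : (𝒜 X).real {B | kmeansCost X B ≤ v * kmeansOpt k X + t} ≤ 1 := measureReal_le_one
  have h2 : (1 - β - β₁ : ℝ) ≤
      (𝒜 X).real {B | kmeansCost X B ≤ v * kmeansOpt k X + t} * (1 - β) := by nlinarith
  exact h2.trans hmain

end
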